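/- Let $n\ge 0$ be an integer and let $B=\mathbb C[X_1,\dots,X_n]$ be graded by giving each $X_i$ a weight $b_i\in\mathbb Z_{>0}$. Let $f_1,\dots,f_n\in B$ be weighted homogeneous, put $A=\mathbb C[f_1,\dots,f_n]\subseteq B$, and suppose that $B$ is a finitely generated $A$-module (a *finite graded polynomial extension*). Let $J=\det(\partial f_i/\partial X_j)_{i,j}$. For a prime ideal $\mathfrak q=(Q)$ of height one in $B$ with $\mathfrak q\cap A=(P)$, the ramification index $e_Q$ is the exponent $v_Q(P)$ of $Q$ in $P$ (equivalently, the largest $k$ with $\mathfrak q\cap A\subseteq \mathfrak q^k$). Let $\operatorname{Spec}_1^{\mathrm{ram}}(B)$ be the set of height-one primes with $e_Q>1$, and for each of them fix a generator $Q$. The extension is called *well-ramified* if $R=\prod_{Q\in\operatorname{Spec}_1^{\mathrm{ram}}(B)}Q^{e_Q}$ lies in $A$ and $(J)\cap A$ is the ideal of $A$ generated by $R$, for some choice of the generators $Q$. Then: 1. $\operatorname{Spec}_1^{\mathrm{ram}}(B)$ is finite and, up to multiplication by a nonzero constant, $$J \doteq \prod_{Q\in\operatorname{Spec}_1^{\mathrm{ram}}(B)}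 Q^{e_Q-1}.$$ 2. If the extension is well-ramified, then for any choice of the generators $Q$ one has $\prod Q^{e_Q}\in A$ and $$(J)\cap A=\Bigl(\prod_{Q\in\operatorname{Spec}_1^{\mathrm{ram}}(B)}Q^{e_Q}\Bigr)\quad\text{as ideals of }A.$$ 3. The extension is well-ramified if and only if, whenever two height-one primes $\mathfrak q,\mathfrak q'$ of $B$ satisfy $\mathfrak q\cap A=\mathfrak q'\cap A$ and $\mathfrak q$ is ramified, $\mathfrak q'$ is ramified as well. -/

import Mathlib

open MvPolynomial

noncomputable section

namespace GradedExt

variable {n : ℕ}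

/-- The subalgebra `A = ℂ[f₁, …, fₙ]` of `B = ℂ[X₁, …, Xₙ]`. -/
abbrev subalg (f : Fin n → MvPolynomial (Fin n) ℂ) : Subalgebra ℂ (MvPolynomial (Fin n) ℂ) :=
  Algebra.adjoin ℂ (Set.range f)

/-- `ℂ[f₁, …, fₙ] ⊆ ℂ[X₁, …, Xₙ]` is a finite graded polynomial extension, where `Xᵢ` has
weight `b i > 0` and `fᵢ` is weighted homogeneous of weight `a i`. -/
structure IsFiniteGraded (b a : Fin n → ℕ) (f : Fin n → MvPolynomial (Fin n) ℂ) : Prop where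
  weight_pos : ∀ i, 0 < b i
  homogeneous : ∀ i, IsWeightedHomogeneous b (f i) (a i)
  finite : Module.Finite (subalg f) (MvPolynomial (Fin n) ℂ)

/-- The Jacobian determinant `det (∂ fᵢ / ∂ Xⱼ)`. -/
def jacobian (f : Fin n → MvPolynomial (Fin n) ℂ) : MvPolynomial (Fin n) ℂ :=
  (Matrix.of fun i j => pderiv j (f i)).det

/-- The set `Spec₁(B)` of prime ideals of height one of `ℂ[X₁, …, Xₙ]`. -/
def specOne (n : ℕ) : Set (Ideal (MvPolynomial (Fin n) ℂ)) :=
  {q | q.IsPrime ∧ q.height = 1}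

/-- The ramification index over `A` of an ideal `q` of `B`: the largest `k` such that
`q ∩ A ⊆ q ^ k`. When `q = (Q)` with `Q` prime and `q ∩ A = (P)` with `P ≠ 0`, this is the
exponent `v_Q(P)` of `Q` in `P`; see `ramIdx_eq_multiplicity`. -/
def ramIdx (f : Fin n → MvPolynomial (Fin n) ℂ) (q : Ideal (MvPolynomial (Fin n) ℂ)) : ℕ :=
  Ideal.ramificationIdx' (q.under (subalg f)) q

theorem ramIdx_eq_multiplicity (f : Fin n → MvPolynomial (Fin n) ℂ)
    (P : subalg f) (Q : MvPolynomial (Fin n) ℂ) (hP : P ≠ 0) (hQ : Prime Q)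
    (h : (Ideal.span {Q}).under (subalg f) = Ideal.span {P}) :
    ramIdx f (Ideal.span {Q}) = multiplicity Q (P : MvPolynomial (Fin n) ℂ) := by
  have hP' : (P : MvPolynomial (Fin n) ℂ) ≠ 0 := fun h0 => hP (Subtype.ext h0)
  have hfin : FiniteMultiplicity Q (P : MvPolynomial (Fin n) ℂ) :=
    FiniteMultiplicity.of_prime_left hQ hP'
  have key : ∀ k : ℕ, Ideal.map (algebraMap (subalg f) (MvPolynomial (Fin n) ℂ))
      (Ideal.span {P}) ≤ Ideal.span {Q} ^ k ↔ Q ^ k ∣ (P : MvPolynomial (Fin n) ℂ) := by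
    intro k
    rw [Ideal.map_span, Set.image_singleton, Ideal.span_singleton_pow,
      Ideal.span_singleton_le_span_singleton]
    rfl
  unfold ramIdx
  rw [h]
  refine Ideal.ramificationIdx'_spec ((key _).2 (pow_multiplicity_dvd _ _)) ?_
  rw [key]
  exact hfin.not_pow_dvd_of_multiplicity_lt (Nat.lt_succ_self _)

/-- The set of ramified primes of height one. -/
def specOneRam (f : Fin n → MvPolynomial (Fin n) ℂ) : Set (Ideal (MvPolynomial (Fin n) ℂ)) :=
  {q | q ∈ specOne n ∧ 1 < ramIdx f q}

/-- `Q` chooses, for every ramified prime `q` of height one, a polynomial `Q q` generating it. -/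
def IsRepSystem (f : Fin n → MvPolynomial (Fin n) ℂ)
    (Q : Ideal (MvPolynomial (Fin n) ℂ) → MvPolynomial (Fin n) ℂ) : Prop :=
  ∀ q ∈ specOneRam f, Ideal.span {Q q} = q

theorem exists_isRepSystem (f : Fin n → MvPolynomial (Fin n) ℂ) : ∃ Q, IsRepSystem f Q := by
  have H : ∀ q : Ideal (MvPolynomial (Fin n) ℂ), ∃ g, q ∈ specOneRam f → Ideal.span {g} = q := by
    intro q
    by_cases hq : q ∈ specOneRam f
    · obtain ⟨⟨h1, h2⟩, -⟩ := hq
      obtain ⟨g, hg⟩ := (UniqueFactorizationMonoid.isPrincipal_of_height_eq_one h2).principal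
      exact ⟨g, fun _ => hg.symm⟩
    · exact ⟨0, fun h => absurd h hq⟩
  choose Q hQ using H
  exact ⟨Q, hQ⟩

/-- The identity `(J) ∩ A = (∏ Q ^ e_Q)` of ideals of `A`, the product being over the ramified
primes of height one; it includes the assertion that `∏ Q ^ e_Q` lies in `A`. -/
def ContractionFormula (f : Fin n → MvPolynomial (Fin n) ℂ)
    (Q : Ideal (MvPolynomial (Fin n) ℂ) → MvPolynomial (Fin n) ℂ) : Prop :=
  ∃ R : subalg f, (R : MvPolynomial (Fin n) ℂ) = ∏ᶠ q ∈ specOneRam f, Q q ^ ramIdx f q ∧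
    (Ideal.span {jacobian f}).under (subalg f) = Ideal.span {R}

/-- The extension is well-ramified: `(J) ∩ A = (∏ Q ^ e_Q)` for some choice of the polynomials
`Q` representing the ramified primes of height one. -/
def WellRamified (f : Fin n → MvPolynomial (Fin n) ℂ) : Prop :=
  ∃ Q, IsRepSystem f Q ∧ ContractionFormula f Q

end GradedExt

end

/-! Everything rests on $v_Q(J)=e_Q-1$ for every height-one prime $(Q)$. Let $(Q)\cap A=(P)$, write
$P=p(f)$ and $P=Q^eU$ with $Q\nmid U$, and replace $f_i$ by $P$ in the Jacobian. The chain rule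
gives $(\partial_i p)(f)\,J$; the product rule gives $Q^{e-1}(Q\,J_U+eU\,J_Q)$, where $J_g$ has
$f_i$ replaced by $g$. Some $i$ has $p\nmid\partial_i p$, so $Q\nmid(\partial_i p)(f)$. It remains
that $Q\nmid J_Q$ (`jacobian_update_notMem`): a Jacobian vanishing mod $Q$ yields a nonzero
derivation into $\operatorname{Frac}(B/Q)$, and integrality over $A$ in characteristic zero excludes
it. Unique factorization then gives the formula for $J$. If ramification depends only on the
contraction, let $N$ be the product of one generator for each contraction of a ramified prime. Then
$N\doteq\prod Q^{e_Q}$, and $J$ divides $x\in A$ iff every ramified $Q$ does, iff $N$ does.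
Conversely, if $\prod Q^{e_Q}$ lies in $A$, it lies in every prime with the same contraction as a
ramified one. -/

open MvPolynomial

/-! ### Derivations and partial derivatives -/

/-- A derivation of an integral extension `B` of `R` with values in a field of characteristic zero
vanishes if it vanishes on the kernel of the structure map. -/
theorem Derivation.eq_zero_of_isIntegral {R B K : Type*} [CommRing R] [CommRing B] [Field K]
    [CharZero K] [Algebra R B] [Algebra B K] [Algebra R K] [IsScalarTower R B K]
    [Algebra.IsIntegral R B] (D : Derivation R B K)
    (hD : ∀ x, algebraMap B K x = 0 → D x = 0) : D = 0 := by
  ext x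
  -- Descent on the degree: `D` applied to `p(x)` gives `p'(x) • D x = 0`, so either `D x = 0` or
  -- `p'` replaces `p`. Characteristic zero keeps the image of `p'` nonzero.
  have key : ∀ d : ℕ, ∀ p : Polynomial R, p.natDegree = d → p.map (algebraMap R K) ≠ 0 →
      algebraMap B K (Polynomial.aeval x p) = 0 → D x = 0 := by
    intro d
    induction d using Nat.strong_induction_on with
    | _ d ih =>
      intro p hpd hp hx
      have hmap : (p.map (algebraMap R K)).natDegree ≠ 0 := by
        intro h0
        rw [Polynomial.eq_C_of_natDegree_eq_zero h0] at hp
        apply hp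
        rw [← Polynomial.aeval_algebraMap_apply, ← Polynomial.aeval_map_algebraMap K,
          Polynomial.eq_C_of_natDegree_eq_zero h0, Polynomial.aeval_C] at hx
        simpa using hx
      have h1 := hD _ hx
      rw [Derivation.map_aeval, Algebra.smul_def] at h1
      rcases mul_eq_zero.1 h1 with h2 | h2
      · refine ih _ ?_ (Polynomial.derivative p) rfl ?_ h2
        · rw [← hpd]
          apply Polynomial.natDegree_derivative_lt
          intro h0
          exact hmap (Nat.le_zero.1 (h0 ▸ Polynomial.natDegree_map_le))
        · rw [← Polynomial.derivative_map]
          exact fun h0 => hmap (Polynomial.derivative_eq_zero.1 h0)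
      · exact h2
  obtain ⟨p, hp, hpx⟩ := Algebra.IsIntegral.isIntegral (R := R) x
  refine key _ p rfl ((hp.map _).ne_zero) ?_
  rw [Polynomial.aeval_def, hpx, map_zero]

/-- The chain rule for a derivation and a polynomial in several variables. -/
theorem Derivation.map_mvPolynomial_aeval {R B M σ : Type*} [CommRing R] [CommRing B]
    [AddCommGroup M] [Algebra R B] [Module B M] [Module R M] [Fintype σ]
    (D : Derivation R B M) (g : σ → B) (p : MvPolynomial σ R) :
    D (aeval g p) = ∑ i, aeval g (pderiv i p) • D (g i) := by
  classical
  induction p using MvPolynomial.induction_on with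
  | C r => simp [← MvPolynomial.algebraMap_eq]
  | add p q hp hq => simp [hp, hq, add_smul, Finset.sum_add_distrib]
  | mul_X p i hp =>
    simp only [map_mul, aeval_X, Derivation.leibniz, hp, pderiv_X, smul_eq_mul, map_add, add_smul,
      Finset.sum_add_distrib, Finset.smul_sum, mul_smul]
    congr 1
    simp [Pi.single_apply]

theorem MvPolynomial.totalDegree_pderiv_lt {σ R : Type*} [CommSemiring R] (i : σ)
    (p : MvPolynomial σ R) (h : pderiv i p ≠ 0) : (pderiv i p).totalDegree < p.totalDegree := by
  have hle : ∀ m ∈ (pderiv i p).support, (m.sum fun _ e => e) + 1 ≤ p.totalDegree := by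
    intro m hm
    rw [mem_support_iff, coeff_pderiv] at hm
    have h1 := le_totalDegree (mem_support_iff.2 (left_ne_zero_of_mul hm))
    rwa [Finsupp.sum_add_index' (fun _ => rfl) (fun _ _ _ => rfl),
      Finsupp.sum_single_index rfl] at h1
  obtain ⟨m, hm⟩ := support_nonempty.2 h
  exact (Finset.sup_lt_iff (lt_of_lt_of_le (Nat.succ_pos _) (hle m hm))).2 hle

/-- Differentiation lowers the total degree, so a partial derivative divisible by `p` is zero; in
characteristic zero, if all are zero then `p` is constant. -/
theorem MvPolynomial.exists_not_dvd_pderiv {σ k : Type*} [Field k] [CharZero k]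
    {p : MvPolynomial σ k} (hp : Prime p) : ∃ i, ¬ p ∣ pderiv i p := by
  classical
  by_contra! h
  have h0 : ∀ i, pderiv i p = 0 := by
    intro i
    by_contra hi
    obtain ⟨q, hq⟩ := h i
    have h1 := totalDegree_pderiv_lt i p hi
    have hq0 : q ≠ 0 := by rintro rfl; exact hi (by simpa using hq)
    rw [hq, totalDegree_mul_of_isDomain hp.ne_zero hq0] at h1
    omega
  have hc : p = C (coeff 0 p) := by
    ext m
    rw [coeff_C]
    split_ifs with hm
    · rw [hm]
    · obtain ⟨i, hi⟩ := Finsupp.ne_iff.1 (Ne.symm hm)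
      have h2 := coeff_pderiv (i := i) p (m - Finsupp.single i 1)
      rw [h0 i, tsub_add_cancel_of_le (by
        rw [Finsupp.single_le_iff]; exact Nat.one_le_iff_ne_zero.2 hi)] at h2
      simpa [Nat.cast_add_one_ne_zero] using h2.symm
  refine hp.not_isUnit ?_
  rw [isUnit_iff_eq_C_of_isReduced]
  refine ⟨_, ?_, hc⟩
  rw [isUnit_iff_ne_zero]
  intro h
  rw [h, C_0] at hc
  exact hp.ne_zero hc

namespace GradedExt

variable {n : ℕ}

/-! ### Jacobians and derivations into residue fields -/

/-- A Jacobian determinant is nonzero modulo `q` if no nonzero derivation into the residue field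
at `q` kills the given polynomials. -/
theorem jacobian_notMem (q : Ideal (MvPolynomial (Fin n) ℂ)) [q.IsPrime]
    (g : Fin n → MvPolynomial (Fin n) ℂ)
    (h : ∀ D : Derivation ℂ (MvPolynomial (Fin n) ℂ) (FractionRing (MvPolynomial (Fin n) ℂ ⧸ q)),
      (∀ i, D (g i) = 0) → D = 0) : jacobian g ∉ q := by
  intro hmem
  have hdet : ((Matrix.of fun i j => pderiv j (g i)).map
      (algebraMap (MvPolynomial (Fin n) ℂ) (FractionRing (MvPolynomial (Fin n) ℂ ⧸ q)))).det = 0 := by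
    rw [← RingHom.mapMatrix_apply, ← RingHom.map_det]
    rw [IsScalarTower.algebraMap_apply _ (MvPolynomial (Fin n) ℂ ⧸ q),
      Ideal.Quotient.algebraMap_eq]
    erw [Ideal.Quotient.eq_zero_iff_mem.2 hmem, map_zero]
  -- A kernel vector `v` of the matrix mod `q` defines the derivation `X j ↦ v j`, which kills every
  -- `g i`.
  obtain ⟨v, hv, hv0⟩ := Matrix.exists_mulVec_eq_zero_iff.2 hdet
  have := h (mkDerivation ℂ v) (fun i => by
    have h1 := (mkDerivation ℂ v).map_mvPolynomial_aeval X (g i)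
    rw [aeval_X_left_apply] at h1
    rw [h1]
    refine Eq.trans ?_ (congrFun hv0 i)
    simp [Matrix.mulVec, dotProduct, Algebra.smul_def, mkDerivation_X])
  apply hv
  ext j
  rw [← mkDerivation_X ℂ v j, this]; rfl

/-- Killing the `f i` makes `D` linear over `A`, so the vanishing result for integral extensions
applies. -/
theorem derivation_eq_zero (f : Fin n → MvPolynomial (Fin n) ℂ)
    [Algebra.IsIntegral (subalg f) (MvPolynomial (Fin n) ℂ)]
    (q : Ideal (MvPolynomial (Fin n) ℂ)) [q.IsPrime]
    (D : Derivation ℂ (MvPolynomial (Fin n) ℂ) (FractionRing (MvPolynomial (Fin n) ℂ ⧸ q)))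
    (hf : ∀ i, D (f i) = 0) (hq : ∀ x ∈ q, D x = 0) : D = 0 := by
  have hA : ∀ x : subalg f, D x = 0 := fun x =>
    Derivation.eqOn_adjoin (D1 := D) (D2 := 0) (by rintro _ ⟨i, rfl⟩; simpa using hf i) x.2
  let D' : Derivation (subalg f) (MvPolynomial (Fin n) ℂ)
      (FractionRing (MvPolynomial (Fin n) ℂ ⧸ q)) :=
    Derivation.mk' (R := subalg f) (A := MvPolynomial (Fin n) ℂ)
      (M := FractionRing (MvPolynomial (Fin n) ℂ ⧸ q))
      { toFun := D
        map_add' := fun _ _ => D.map_add _ _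
        map_smul' := fun r x => by
          have : D (algebraMap (subalg f) _ r) = 0 := hA r
          rw [Algebra.smul_def, D.leibniz, this, smul_zero, add_zero, algebraMap_smul]
          rfl } (fun x y => D.leibniz x y)
  have : CharZero (FractionRing (MvPolynomial (Fin n) ℂ ⧸ q)) :=
    charZero_of_injective_algebraMap (algebraMap ℂ _).injective
  have h := D'.eq_zero_of_isIntegral (fun x hx => hq x (by
    rw [IsScalarTower.algebraMap_apply _ (MvPolynomial (Fin n) ℂ ⧸ q)] at hx
    have := (FaithfulSMul.algebraMap_injective _ _) (hx.trans (map_zero _).symm)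
    exact Ideal.Quotient.eq_zero_iff_mem.1 this))
  ext i
  exact DFunLike.congr_fun h (X i)

theorem jacobian_ne_zero (f : Fin n → MvPolynomial (Fin n) ℂ)
    [Algebra.IsIntegral (subalg f) (MvPolynomial (Fin n) ℂ)] : jacobian f ≠ 0 :=
  jacobian_notMem ⊥ f fun D hD => derivation_eq_zero f ⊥ D hD (by simp +contextual)

theorem algebraicIndependent (f : Fin n → MvPolynomial (Fin n) ℂ)
    [Algebra.IsIntegral (subalg f) (MvPolynomial (Fin n) ℂ)] : AlgebraicIndependent ℂ f := by
  have : Algebra.IsAlgebraic (subalg f) (MvPolynomial (Fin n) ℂ) := inferInstance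
  exact (Algebra.IsAlgebraic.isTranscendenceBasis_of_le_trdeg_of_finite ℂ f (by simp)).1

theorem uniqueFactorizationMonoid_subalg (f : Fin n → MvPolynomial (Fin n) ℂ)
    [Algebra.IsIntegral (subalg f) (MvPolynomial (Fin n) ℂ)] :
    UniqueFactorizationMonoid (subalg f) :=
  (algebraicIndependent f).aevalEquiv.toMulEquiv.uniqueFactorizationMonoid inferInstance

/-! ### Contractions of height-one primes -/

/-- By going down, the contraction of a prime of height one is generated by a prime element. -/
theorem exists_under_eq_span (f : Fin n → MvPolynomial (Fin n) ℂ)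
    [Algebra.IsIntegral (subalg f) (MvPolynomial (Fin n) ℂ)]
    {q : Ideal (MvPolynomial (Fin n) ℂ)} (hq : q ∈ specOne n) :
    ∃ P : subalg f, Prime P ∧ q.under (subalg f) = Ideal.span {P} := by
  have := uniqueFactorizationMonoid_subalg f
  obtain ⟨hqp, hqh⟩ := hq
  have hne : q.under (subalg f) ≠ ⊥ := by
    obtain ⟨x, hx, hx0⟩ := Submodule.exists_mem_ne_zero_of_ne_bot (q.ne_bot_of_height_eq_one hqh)
    exact Ideal.comap_ne_bot_of_integral_mem hx0 hx (Algebra.IsIntegral.isIntegral x)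
  obtain ⟨P, hPmem, hP⟩ := Ideal.IsPrime.exists_mem_prime_of_ne_bot inferInstance hne
  refine ⟨P, hP, ?_⟩
  by_contra hcon
  have hPp : (Ideal.span {P}).IsPrime := (Ideal.span_singleton_prime hP.ne_zero).2 hP
  have hlt : Ideal.span {P} < q.under (subalg f) :=
    lt_of_le_of_ne ((Ideal.span_singleton_le_iff_mem _).2 hPmem) (Ne.symm hcon)
  -- Going down applies because `A`, being factorial, is integrally closed. The prime found lies
  -- strictly below `q`, hence is `⊥`, yet contains `P`.
  obtain ⟨q', hq', hq'p, hover⟩ := Ideal.exists_ideal_lt_liesOver_of_lt q hlt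
  have h0 : q'.height < 1 := by
    rw [← hqh]
    exact Ideal.height_strict_mono_of_isPrime_of_isPrime hq'
  have : q' = ⊥ := by
    rwa [← Ideal.height_eq_zero_iff_eq_bot, ← Order.lt_one_iff]
  have h2 : P ∈ q'.under (subalg f) := by
    rw [← hover.over]; exact Ideal.mem_span_singleton_self P
  rw [this] at h2
  apply hP.ne_zero
  exact Subtype.ext (by simpa using h2)

theorem prime_of_span_mem_specOne {Q : MvPolynomial (Fin n) ℂ}
    (hq : Ideal.span {Q} ∈ specOne n) : Prime Q := by
  obtain ⟨hqp, hqh⟩ := hq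
  refine (Ideal.span_singleton_prime fun h0 => ?_).1 hqp
  exact Ideal.ne_bot_of_height_eq_one hqh (Ideal.span_singleton_eq_bot.2 h0)

theorem span_mem_specOne {Q : MvPolynomial (Fin n) ℂ} (hQ : Prime Q) :
    Ideal.span {Q} ∈ specOne n := by
  have hp : (Ideal.span {Q}).IsPrime := (Ideal.span_singleton_prime hQ.ne_zero).2 hQ
  refine ⟨hp, le_antisymm ?_ ?_⟩
  · exact Ideal.height_le_one_of_isPrincipal_of_mem_minimalPrimes (Ideal.span {Q}) _
      (by rw [Ideal.minimalPrimes_eq_subsingleton_self]; rfl)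
  · rw [Order.one_le_iff_ne_zero, Ne, Ideal.height_eq_zero_iff_eq_bot, Ideal.span_singleton_eq_bot]
    exact hQ.ne_zero

theorem exists_generator_under (f : Fin n → MvPolynomial (Fin n) ℂ)
    [Algebra.IsIntegral (subalg f) (MvPolynomial (Fin n) ℂ)]
    {q : Ideal (MvPolynomial (Fin n) ℂ)} {Q : MvPolynomial (Fin n) ℂ}
    (hQq : Ideal.span {Q} = q) (hq : q ∈ specOne n) :
    ∃ P : subalg f, Prime P ∧ (∀ x : subalg f, Q ∣ x ↔ P ∣ x) ∧
      q.under (subalg f) = Ideal.span {P} ∧ 0 < ramIdx f q ∧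
      Q ^ ramIdx f q ∣ (P : MvPolynomial (Fin n) ℂ) ∧
      ¬ Q ^ (ramIdx f q + 1) ∣ (P : MvPolynomial (Fin n) ℂ) := by
  subst hQq
  obtain ⟨P, hP, hu⟩ := exists_under_eq_span f hq
  have hQ := prime_of_span_mem_specOne hq
  have hP0 : (P : MvPolynomial (Fin n) ℂ) ≠ 0 := fun h0 => hP.ne_zero (Subtype.ext h0)
  have hfin : FiniteMultiplicity Q (P : MvPolynomial (Fin n) ℂ) :=
    FiniteMultiplicity.of_prime_left hQ hP0
  have hdvd : ∀ x : subalg f, Q ∣ x ↔ P ∣ x := fun x => by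
    rw [← Ideal.mem_span_singleton, ← Ideal.mem_span_singleton, ← hu]
    rfl
  have hmult := ramIdx_eq_multiplicity f P Q hP.ne_zero hQ hu
  refine ⟨P, hP, hdvd, hu, ?_, ?_, ?_⟩
  · rw [hmult, pos_iff_ne_zero, Ne, multiplicity_eq_zero, not_not, hdvd]
  · rw [hmult]
    exact pow_multiplicity_dvd _ _
  · rw [hmult]
    exact hfin.not_pow_dvd_of_multiplicity_lt (Nat.lt_succ_self _)

/-! ### Multiplicity of a prime in the Jacobian -/

theorem jacobian_update (f : Fin n → MvPolynomial (Fin n) ℂ) (i : Fin n)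
    (g : MvPolynomial (Fin n) ℂ) : jacobian (Function.update f i g) =
      ((Matrix.of fun i j => pderiv j (f i)).updateRow i fun j => pderiv j g).det := by
  unfold jacobian
  congr 1
  ext k j
  by_cases h : k = i
  · subst h; simp
  · simp [h]

/-- By the chain rule the new row is a combination of the old rows, of which only the `i`-th
contributes to the determinant. -/
theorem jacobian_update_aeval (f : Fin n → MvPolynomial (Fin n) ℂ) (i : Fin n)
    (p : MvPolynomial (Fin n) ℂ) :
    jacobian (Function.update f i (aeval f p)) = aeval f (pderiv i p) * jacobian f := by
  rw [jacobian_update]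
  have h : (fun j => pderiv j (aeval f p)) = ∑ k, aeval f (pderiv k p) •
      (Matrix.of fun i j => pderiv j (f i)) k := by
    ext1 j
    rw [(pderiv j).map_mvPolynomial_aeval]
    simp
  rw [h, Matrix.det_updateRow_sum]
  rfl

theorem jacobian_update_mul (f : Fin n → MvPolynomial (Fin n) ℂ) (i : Fin n)
    (g h : MvPolynomial (Fin n) ℂ) : jacobian (Function.update f i (g * h)) =
      g * jacobian (Function.update f i h) + h * jacobian (Function.update f i g) := by
  simp only [jacobian_update]
  have : (fun j => pderiv j (g * h)) =
      g • (fun j => pderiv j h) + h • (fun j => pderiv j g) := by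
    ext1 j
    simp [Derivation.leibniz]
  rw [this, Matrix.det_updateRow_add, Matrix.det_updateRow_smul, Matrix.det_updateRow_smul]

theorem jacobian_update_pow (f : Fin n → MvPolynomial (Fin n) ℂ) (i : Fin n)
    (g : MvPolynomial (Fin n) ℂ) (e : ℕ) : jacobian (Function.update f i (g ^ e)) =
      e * g ^ (e - 1) * jacobian (Function.update f i g) := by
  simp only [jacobian_update]
  have : (fun j => pderiv j (g ^ e)) = (e * g ^ (e - 1) : MvPolynomial (Fin n) ℂ) •
      (fun j => pderiv j g) := by
    ext1 j
    simp [mul_assoc]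
  rw [this, Matrix.det_updateRow_smul]

theorem jacobian_update_notMem (f : Fin n → MvPolynomial (Fin n) ℂ)
    [Algebra.IsIntegral (subalg f) (MvPolynomial (Fin n) ℂ)] {Q : MvPolynomial (Fin n) ℂ}
    (hQ : Prime Q) (p : MvPolynomial (Fin n) ℂ) (i : Fin n) (hp : Q ∣ aeval f p)
    (hi : ¬ Q ∣ aeval f (pderiv i p)) : ¬ Q ∣ jacobian (Function.update f i Q) := by
  have hqp : (Ideal.span {Q}).IsPrime := (Ideal.span_singleton_prime hQ.ne_zero).2 hQ
  rw [← Ideal.mem_span_singleton] at hi ⊢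
  have hzero : ∀ x : MvPolynomial (Fin n) ℂ, x ∈ Ideal.span {Q} ↔
      algebraMap _ (FractionRing (MvPolynomial (Fin n) ℂ ⧸ Ideal.span {Q})) x = 0 := by
    intro x
    rw [IsScalarTower.algebraMap_apply _ (MvPolynomial (Fin n) ℂ ⧸ Ideal.span {Q}),
      FaithfulSMul.algebraMap_eq_zero_iff]
    exact Ideal.Quotient.eq_zero_iff_mem.symm
  refine jacobian_notMem _ _ fun D hD => ?_
  have hDQ : D Q = 0 := by simpa using hD i
  have hDf : ∀ k, k ≠ i → D (f k) = 0 := fun k hk => by simpa [hk] using hD k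
  have hDq : ∀ x ∈ Ideal.span {Q}, D x = 0 := by
    intro x hx
    have h0 := (hzero Q).1 (Ideal.mem_span_singleton_self Q)
    obtain ⟨y, rfl⟩ := Ideal.mem_span_singleton.1 hx
    rw [D.leibniz, hDQ, smul_zero, add_zero, Algebra.smul_def, h0, zero_mul]
  refine derivation_eq_zero f _ D (fun k => ?_) hDq
  by_cases hk : k = i
  · subst hk
    -- Since `D` kills `p(f)` and all `f j` with `j ≠ k`, the chain rule leaves `(∂ₖp)(f) • D (f k)
    -- = 0`, whose coefficient is nonzero mod `Q`.
    have h1 := hDq _ (Ideal.mem_span_singleton.2 hp)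
    rw [D.map_mvPolynomial_aeval, Finset.sum_eq_single_of_mem k (Finset.mem_univ _)
      (fun j _ hj => by rw [hDf j hj, smul_zero]), Algebra.smul_def] at h1
    exact (mul_eq_zero.1 h1).resolve_left fun h => hi ((hzero _).2 h)
  · exact hDf k hk

/-- A prime of height one with ramification index `e` occurs in the Jacobian exactly `e - 1` times. -/
theorem pow_dvd_jacobian (f : Fin n → MvPolynomial (Fin n) ℂ)
    [Algebra.IsIntegral (subalg f) (MvPolynomial (Fin n) ℂ)]
    {q : Ideal (MvPolynomial (Fin n) ℂ)} {Q : MvPolynomial (Fin n) ℂ}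
    (hQq : Ideal.span {Q} = q) (hq : q ∈ specOne n) :
    Q ^ (ramIdx f q - 1) ∣ jacobian f ∧ ¬ Q ^ ramIdx f q ∣ jacobian f := by
  obtain ⟨P, hP, hdvd, -, he, hPe, hPe'⟩ := exists_generator_under f hQq hq
  subst hQq
  have hQ := prime_of_span_mem_specOne hq
  set e := ramIdx f (Ideal.span {Q})
  let φ := (algebraicIndependent f).aevalEquiv
  obtain ⟨p, rfl⟩ := φ.surjective P
  have hφ : ∀ r, (φ r : MvPolynomial (Fin n) ℂ) = aeval f r := fun r =>
    (algebraicIndependent f).algebraMap_aevalEquiv r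
  have hdvd' : ∀ r, Q ∣ aeval f r ↔ p ∣ r := fun r => by
    rw [← hφ, hdvd]
    exact map_dvd_iff φ
  obtain ⟨i, hi⟩ := exists_not_dvd_pderiv ((MulEquiv.prime_iff φ.toMulEquiv).1 hP)
  rw [← hdvd'] at hi
  have hD := jacobian_update_notMem f hQ p i ((hdvd' p).2 dvd_rfl) hi
  have hJ := jacobian_update_aeval f i p
  rw [hφ] at hPe hPe'
  obtain ⟨U, hU⟩ := hPe
  have hQU : ¬ Q ∣ U := by
    rintro ⟨V, rfl⟩
    exact hPe' ⟨V, by rw [hU]; ring⟩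
  have hfac : aeval f (pderiv i p) * jacobian f = Q ^ (e - 1) *
      (Q * jacobian (Function.update f i U) + e * (U * jacobian (Function.update f i Q))) := by
    rw [← hJ, hU, jacobian_update_mul, jacobian_update_pow]
    nth_rewrite 1 [← Nat.sub_add_cancel he]
    ring
  have h1 : Q ^ (e - 1) ∣ jacobian f :=
    hQ.pow_dvd_of_dvd_mul_left _ hi ⟨_, hfac⟩
  refine ⟨h1, fun h2 => ?_⟩
  have h3 : Q ^ (e - 1) * Q ∣ aeval f (pderiv i p) * jacobian f := by
    rw [← pow_succ, Nat.sub_add_cancel he]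
    exact h2.mul_left _
  rw [hfac] at h3
  -- Cancelling `Q ^ (e - 1)` leaves `Q ∣ e * (U * J_Q)`, where `e` is a unit and `Q` divides
  -- neither other factor.
  have h4 := (mul_dvd_mul_iff_left (pow_ne_zero _ hQ.ne_zero)).1 h3
  rw [dvd_add_right (dvd_mul_right _ _)] at h4
  rcases hQ.dvd_or_dvd h4 with h5 | h5
  · have hu : IsUnit (e : MvPolynomial (Fin n) ℂ) := by
      rw [isUnit_iff_eq_C_of_isReduced]
      exact ⟨e, isUnit_iff_ne_zero.2 (Nat.cast_ne_zero.2 he.ne'), by simp⟩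
    exact hQ.not_isUnit (isUnit_of_dvd_unit h5 hu)
  · exact (hQ.dvd_or_dvd h5).elim hQU hD

/-! ### Factorization over height-one primes -/

theorem finite_specOne_dvd {g : MvPolynomial (Fin n) ℂ} (hg : g ≠ 0) :
    {q ∈ specOne n | g ∈ q}.Finite := by
  refine ((UniqueFactorizationMonoid.factors g).toFinset.image
    fun p => Ideal.span {p}).finite_toSet.subset ?_
  rintro q ⟨hq, hgq⟩
  have := hq.1
  obtain ⟨p, rfl⟩ := (UniqueFactorizationMonoid.isPrincipal_of_height_eq_one hq.2).principal
  have hp := prime_of_span_mem_specOne hq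
  obtain ⟨r, hr, hpr⟩ := UniqueFactorizationMonoid.exists_mem_factors_of_dvd hg hp.irreducible
    (Ideal.mem_span_singleton.1 hgq)
  simp only [Finset.coe_image, Set.mem_image, Finset.mem_coe, Multiset.mem_toFinset]
  exact ⟨r, hr, (Ideal.span_singleton_eq_span_singleton.2 hpr).symm⟩

theorem prod_prime_dvd {R ι : Type*} [CommRing R] [UniqueFactorizationMonoid R]
    (s : Finset ι) (p : ι → R) (m : ι → ℕ) (hp : ∀ i ∈ s, Prime (p i))
    (hne : ∀ i ∈ s, ∀ j ∈ s, p i ∣ p j → i = j) {g : R} (hg : ∀ i ∈ s, p i ^ m i ∣ g) :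
    ∏ i ∈ s, p i ^ m i ∣ g := by
  refine Finset.prod_dvd_of_isRelPrime (fun i hi j hj hij => ?_) hg
  exact ((hp i hi).irreducible.isRelPrime_iff_not_dvd.2
    fun h => hij (hne i hi j hj h)).pow

/-- A prime factor of the cofactor would generate some `q ∈ S` and raise the multiplicity of `Q q`
beyond `m q`; so the cofactor is a unit. -/
theorem associated_finprod {S : Set (Ideal (MvPolynomial (Fin n) ℂ))} (hS : S ⊆ specOne n)
    (hfin : S.Finite) (Q : Ideal (MvPolynomial (Fin n) ℂ) → MvPolynomial (Fin n) ℂ)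
    (hQ : ∀ q ∈ S, Ideal.span {Q q} = q) (m : Ideal (MvPolynomial (Fin n) ℂ) → ℕ)
    {g : MvPolynomial (Fin n) ℂ}
    (hg : g ≠ 0) (hdvd : ∀ q ∈ S, Q q ^ m q ∣ g) (hndvd : ∀ q ∈ S, ¬ Q q ^ (m q + 1) ∣ g)
    (hprime : ∀ p, Prime p → p ∣ g → Ideal.span {p} ∈ S) :
    Associated g (∏ᶠ q ∈ S, Q q ^ m q) := by
  rw [finprod_mem_eq_finite_toFinset_prod _ hfin]
  have hQp : ∀ q ∈ S, Prime (Q q) := fun q hq =>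
    prime_of_span_mem_specOne (by rw [hQ q hq]; exact hS hq)
  obtain ⟨u, hu⟩ : ∏ q ∈ hfin.toFinset, Q q ^ m q ∣ g := by
    refine prod_prime_dvd _ _ _ (by simpa using hQp) ?_ (by simpa using hdvd)
    intro q hq q' hq' h
    rw [Set.Finite.mem_toFinset] at hq hq'
    rw [← hQ q hq, ← hQ q' hq', Ideal.span_singleton_eq_span_singleton]
    exact (hQp q hq).associated_of_dvd (hQp q' hq') h
  suffices hunit : IsUnit u by
    rw [hu]
    exact associated_mul_unit_left _ _ hunit
  by_contra hunit
  have hu0 : u ≠ 0 := by rintro rfl; exact hg (by rw [hu, mul_zero])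
  obtain ⟨p, hp, hpu⟩ := WfDvdMonoid.exists_irreducible_factor hunit hu0
  have hpS := hprime p hp.prime (hu ▸ hpu.mul_left _)
  apply hndvd _ hpS
  rw [hu, pow_succ]
  refine mul_dvd_mul (Finset.dvd_prod_of_mem (fun q => Q q ^ m q)
    (hfin.mem_toFinset.2 hpS)) (Dvd.dvd.trans ?_ hpu)
  exact (Ideal.span_singleton_eq_span_singleton.1 (hQ _ hpS)).dvd

/-! ### The Jacobian and its contraction -/

section

variable (f : Fin n → MvPolynomial (Fin n) ℂ)
  [Algebra.IsIntegral (subalg f) (MvPolynomial (Fin n) ℂ)]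

theorem specOneRam_finite : (specOneRam f).Finite := by
  refine (finite_specOne_dvd (jacobian_ne_zero f)).subset fun q hq => ⟨hq.1, ?_⟩
  obtain ⟨Q, hQ⟩ := exists_isRepSystem f
  rw [← hQ q hq, Ideal.mem_span_singleton]
  exact (dvd_pow_self _ (Nat.sub_ne_zero_of_lt hq.2)).trans (pow_dvd_jacobian f (hQ q hq) hq.1).1

variable {f} {Q : Ideal (MvPolynomial (Fin n) ℂ) → MvPolynomial (Fin n) ℂ}

theorem jacobian_associated (hQ : IsRepSystem f Q) :
    Associated (jacobian f) (∏ᶠ q ∈ specOneRam f, Q q ^ (ramIdx f q - 1)) := by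
  refine associated_finprod (fun q hq => hq.1) (specOneRam_finite f) Q hQ
    (fun q => ramIdx f q - 1) (jacobian_ne_zero f)
    (fun q hq => (pow_dvd_jacobian f (hQ q hq) hq.1).1) ?_ ?_
  · intro q hq
    simp only [Nat.sub_add_cancel hq.2.le]
    exact (pow_dvd_jacobian f (hQ q hq) hq.1).2
  · intro p hp hpJ
    refine ⟨span_mem_specOne hp, ?_⟩
    have h := (pow_dvd_jacobian f rfl (span_mem_specOne hp)).2
    by_contra hle
    exact h (((pow_dvd_pow p (not_lt.1 hle)).trans (pow_one p).dvd).trans hpJ)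

/-- If ramification depends only on the contraction, the Jacobian contracts to `∏ Q ^ e_Q`. -/
theorem contractionFormula (hQ : IsRepSystem f Q)
    (hram : ∀ q ∈ specOne n, ∀ q' ∈ specOne n, q.under (subalg f) = q'.under (subalg f) →
      q ∈ specOneRam f → q' ∈ specOneRam f) : ContractionFormula f Q := by
  classical
  have hfin := specOneRam_finite f
  have := uniqueFactorizationMonoid_subalg f
  have hG : ∀ q : Ideal (subalg f), ∃ P : subalg f, (∃ q' ∈ specOne n, q'.under (subalg f) = q) →
      Prime P ∧ q = Ideal.span {P} := by
    intro q
    by_cases h : ∃ q' ∈ specOne n, q'.under (subalg f) = q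
    · obtain ⟨q', hq', rfl⟩ := h
      obtain ⟨P, hP⟩ := exists_under_eq_span f hq'
      exact ⟨P, fun _ => hP⟩
    · exact ⟨0, fun h' => absurd h' h⟩
  choose G hG using hG
  -- Taking the image counts each contraction once, however many ramified primes lie over it.
  let S := hfin.toFinset.image fun q => q.under (subalg f)
  have hS : ∀ p ∈ S, Prime (G p) ∧ p = Ideal.span {G p} := by
    intro p hp
    obtain ⟨q, hq, rfl⟩ := Finset.mem_image.1 hp
    exact hG _ ⟨q, (hfin.mem_toFinset.1 hq).1, rfl⟩
  have hSinj : ∀ p ∈ S, ∀ p' ∈ S, G p ∣ G p' → p = p' := by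
    intro p hp p' hp' h
    rw [(hS p hp).2, (hS p' hp').2, Ideal.span_singleton_eq_span_singleton]
    exact (hS p hp).1.associated_of_dvd (hS p' hp').1 h
  have hSmem : ∀ q ∈ specOneRam f, q.under (subalg f) ∈ S := fun q hq =>
    Finset.mem_image.2 ⟨q, hfin.mem_toFinset.2 hq, rfl⟩
  have hgen : ∀ q ∈ specOneRam f, (∀ x : subalg f, Q q ∣ x ↔ G (q.under (subalg f)) ∣ x) ∧
      Q q ^ ramIdx f q ∣ (G (q.under (subalg f)) : MvPolynomial (Fin n) ℂ) ∧
      ¬ Q q ^ (ramIdx f q + 1) ∣ (G (q.under (subalg f)) : MvPolynomial (Fin n) ℂ) := by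
    intro q hq
    obtain ⟨P, hP, hdvd, hu, -, h1, h2⟩ := exists_generator_under f (hQ q hq) hq.1
    have hass : Associated P (G (q.under (subalg f))) := by
      rw [← Ideal.span_singleton_eq_span_singleton, ← hu]
      exact (hS _ (hSmem q hq)).2
    have hass' : Associated (P : MvPolynomial (Fin n) ℂ) (G (q.under (subalg f))) :=
      hass.map (subalg f).val
    exact ⟨fun x => by rw [hdvd, hass.dvd_iff_dvd_left], by rwa [← hass'.dvd_iff_dvd_right],
      by rwa [← hass'.dvd_iff_dvd_right]⟩
  have hQp : ∀ q ∈ specOneRam f, Prime (Q q) := fun q hq =>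
    prime_of_span_mem_specOne (by rw [hQ q hq]; exact hq.1)
  let N : subalg f := ∏ p ∈ S, G p
  have hass : Associated (N : MvPolynomial (Fin n) ℂ) (∏ᶠ q ∈ specOneRam f, Q q ^ ramIdx f q) := by
    refine associated_finprod (fun q hq => hq.1) hfin Q hQ (ramIdx f) ?_ ?_ ?_ ?_
    · exact fun h => Finset.prod_ne_zero_iff.2 (fun p hp => (hS p hp).1.ne_zero) (Subtype.ext h)
    · intro q hq
      refine (hgen q hq).2.1.trans ?_
      exact map_dvd (subalg f).val (Finset.dvd_prod_of_mem G (hSmem q hq))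
    · intro q hq h
      -- Only the factor of `N` belonging to the contraction of `q` is divisible by `Q q`, so the
      -- multiplicity in `N` is that in this factor.
      have hfac := Finset.mul_prod_erase S G (hSmem q hq)
      have hnd : ¬ Q q ∣ ((∏ p ∈ S.erase (q.under (subalg f)), G p : subalg f) :
          MvPolynomial (Fin n) ℂ) := by
        rw [(hgen q hq).1, (hS _ (hSmem q hq)).1.dvd_finsetProd_iff]
        rintro ⟨p, hp, hdvd⟩
        rw [Finset.mem_erase] at hp
        exact hp.1 (hSinj _ (hSmem q hq) p hp.2 hdvd).symm
      refine (hgen q hq).2.2 ((hQp q hq).pow_dvd_of_dvd_mul_right _ hnd ?_)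
      rw [← MulMemClass.coe_mul, hfac]
      exact h
    · intro r hr hdvd
      obtain ⟨P, hP, hPdvd, hu, -⟩ := exists_generator_under f rfl (span_mem_specOne hr)
      rw [hPdvd, hP.dvd_finsetProd_iff] at hdvd
      obtain ⟨p, hp, hPp⟩ := hdvd
      have hup : (Ideal.span {r}).under (subalg f) = p := by
        rw [hu, (hS p hp).2, Ideal.span_singleton_eq_span_singleton]
        exact hP.associated_of_dvd (hS p hp).1 hPp
      -- A prime factor of `N` has the same contraction as some ramified `q`; `hram` makes it
      -- ramified.
      obtain ⟨q, hq, rfl⟩ := Finset.mem_image.1 hp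
      rw [hfin.mem_toFinset] at hq
      exact hram q hq.1 _ (span_mem_specOne hr) hup.symm hq
  have hJ : (Ideal.span {jacobian f}).under (subalg f) = Ideal.span {N} := by
    ext x
    rw [Ideal.mem_span_singleton]
    change (x : MvPolynomial (Fin n) ℂ) ∈ Ideal.span {jacobian f} ↔ _
    rw [Ideal.mem_span_singleton]
    constructor
    · intro h
      have h1 := prod_prime_dvd S G (fun _ => 1) (fun p hp => (hS p hp).1) hSinj (g := x) ?_
      · simpa using h1
      · intro p hp
        obtain ⟨q, hq, rfl⟩ := Finset.mem_image.1 hp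
        rw [hfin.mem_toFinset] at hq
        rw [pow_one, ← (hgen q hq).1]
        exact ((dvd_pow_self _ (Nat.sub_ne_zero_of_lt hq.2)).trans
          (pow_dvd_jacobian f (hQ q hq) hq.1).1).trans h
    · intro h
      rw [(jacobian_associated hQ).dvd_iff_dvd_left]
      refine Dvd.dvd.trans ?_ (hass.symm.dvd.trans (map_dvd (subalg f).val h))
      rw [finprod_mem_eq_finite_toFinset_prod _ hfin, finprod_mem_eq_finite_toFinset_prod _ hfin]
      exact Finset.prod_dvd_prod_of_dvd _ _ fun q _ => pow_dvd_pow _ (Nat.sub_le _ _)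
  obtain ⟨u, hu⟩ := hass
  -- Units of `B` are constants, hence lie in `A`; this puts the product itself in `A` for any
  -- choice of generators.
  obtain ⟨c, hc, huc⟩ := isUnit_iff_eq_C_of_isReduced.1 u.isUnit
  refine ⟨N * algebraMap ℂ (subalg f) c, ?_, ?_⟩
  · rw [← hu, huc]; rfl
  · rw [hJ, Ideal.span_singleton_eq_span_singleton]
    exact associated_mul_unit_right _ _ (hc.map _)

/-- As `R` lies in `q ∩ A = q' ∩ A`, some ramified generator lies in `q'`, and height one forces it
to generate `q'`. -/
theorem mem_specOneRam_of_wellRamified (h : WellRamified f)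
    {q q' : Ideal (MvPolynomial (Fin n) ℂ)} (hq' : q' ∈ specOne n)
    (hu : q.under (subalg f) = q'.under (subalg f)) (hq : q ∈ specOneRam f) :
    q' ∈ specOneRam f := by
  obtain ⟨Q, hQ, R, hR, -⟩ := h
  have hfin := specOneRam_finite f
  rw [finprod_mem_eq_finite_toFinset_prod _ hfin] at hR
  have hRq : R ∈ q.under (subalg f) := by
    change (R : MvPolynomial (Fin n) ℂ) ∈ q
    rw [← hQ q hq, Ideal.mem_span_singleton, hR]
    exact (dvd_pow_self _ (Nat.ne_of_gt (zero_lt_one.trans hq.2))).trans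
      (Finset.dvd_prod_of_mem (fun q => Q q ^ ramIdx f q) (hfin.mem_toFinset.2 hq))
  rw [hu] at hRq
  replace hRq : (R : MvPolynomial (Fin n) ℂ) ∈ q' := hRq
  have := hq'.1
  rw [hR, Ideal.IsPrime.prod_mem_iff] at hRq
  obtain ⟨r, hr, hmem⟩ := hRq
  rw [hfin.mem_toFinset] at hr
  have hQr : Prime (Q r) := prime_of_span_mem_specOne (by rw [hQ r hr]; exact hr.1)
  rwa [Ideal.eq_span_singleton_of_height_eq_one hq'.2
    (Ideal.IsPrime.mem_of_pow_mem this _ hmem) hQr, hQ r hr]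

end

end GradedExt

theorem mainTheorem6 (n : ℕ) (b a : Fin n → ℕ) (f : Fin n → MvPolynomial (Fin n) ℂ)
    (hf : GradedExt.IsFiniteGraded b a f)
    (Q : Ideal (MvPolynomial (Fin n) ℂ) → MvPolynomial (Fin n) ℂ)
    (hQ : GradedExt.IsRepSystem f Q) :
    (GradedExt.specOneRam f).Finite ∧
    Associated (GradedExt.jacobian f)
      (∏ᶠ q ∈ GradedExt.specOneRam f, Q q ^ (GradedExt.ramIdx f q - 1)) ∧
    (GradedExt.WellRamified f →
      ∃ R : GradedExt.subalg f,
        (R : MvPolynomial (Fin n) ℂ) = ∏ᶠ q ∈ GradedExt.specOneRam f, Q q ^ GradedExt.ramIdx f q ∧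
        (Ideal.span {GradedExt.jacobian f}).under (GradedExt.subalg f) = Ideal.span {R}) ∧
    (GradedExt.WellRamified f ↔
      ∀ q ∈ GradedExt.specOne n, ∀ q' ∈ GradedExt.specOne n,
        q.under (GradedExt.subalg f) = q'.under (GradedExt.subalg f) →
        q ∈ GradedExt.specOneRam f → q' ∈ GradedExt.specOneRam f) := by
  have := hf.finite
  have hram := fun (h : GradedExt.WellRamified f) q (_ : q ∈ GradedExt.specOne n) q' hq' hu hq =>
    GradedExt.mem_specOneRam_of_wellRamified (q := q) (q' := q') h hq' hu hq
  exact ⟨GradedExt.specOneRam_finite f, GradedExt.jacobian_associated hQ,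
    fun h => GradedExt.contractionFormula hQ (hram h),
    hram, fun h => ⟨Q, hQ, GradedExt.contractionFormula hQ h⟩⟩
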